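/- For a probability vector $P=(p_1,\dots,p_n)$ (that is, $n\ge 1$, $p_i\ge 0$, $\sum_i p_i=1$) and $\alpha\in(0,\infty)\setminus\{1\}$ let $H_\alpha(P)=\frac{1}{1-\alpha}\log\sum_i p_i^\alpha$ be its Rényi entropy, with $H_1(P)=-\sum_i p_i\log p_i$ and $H_\infty(P)=-\log\max_i p_i$. Let $0<\alpha_1<\alpha_2\le\infty$. (a) Let $n\ge 1$, and on an $n$-element set let $U_1=(0,\dots,0,1)$ and $U_n=(\frac1n,\dots,\frac1n)$. For every probability vector $P$ on $n$ points there is a mixture $Q=sU_1+(1-s)U_n$, $s\in[0,1]$, with $H_{\alpha_1}(Q)=H_{\alpha_1}(P)$, such that $H_{\alpha_2}(Q)\le H_{\alpha_2}(R)$ for every probability vector $R$ on $n$ points with $H_{\alpha_1}(R)=H_{\alpha_1}(P)$. That is, for fixed $H_{\alpha_1}$ the minimum of $H_{\alpha_2}$ is attained by a mixture of $U_1$ and $U_n$. (b) Let $h>0$, and put $$b=\begin{cases}0, & \alpha_1\le 1,\\[2pt] \dfrac{\alpha_2}{\alpha_2-1}\cdot\dfrac{\alpha_1-1}{\alpha_1}\,h,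 & \alpha_1>1,\end{cases}$$ where $\frac{\alpha_2}{\alpha_2-1}$ is read as $1$ if $\alpha_2=\infty$. Every probability vector $P$ of any finite length with $H_{\alpha_1}(P)=h$ satisfies $H_{\alpha_2}(P)>b$. This bound is tight: $b$ is the infimum of $H_{\alpha_2}(P)$ over all probability vectors $P$ of any finite length with $H_{\alpha_1}(P)=h$. -/

import Mathlib

open scoped ENNReal

/-- The Rényi entropy of order `α ∈ [0, ∞]` of a probability vector `p`, with the values at the
orders `0`, `1` and `∞` given by continuous extension. -/
noncomputable def renyiEntropy {n : ℕ} (α : ℝ≥0∞) (p : Fin n → ℝ) : ℝ :=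
  if α = 0 then Real.log ({i : Fin n | p i ≠ 0}.ncard : ℝ)
  else if α = 1 then -∑ i, p i * Real.log (p i)
  else if α = ∞ then -Real.log (⨆ i, p i)
  else 1 / (1 - α.toReal) * Real.log (∑ i, p i ^ α.toReal)

/-- The uniform distribution `U_k = (0, …, 0, 1/k, …, 1/k)` on the last `k` of the `n` points. -/
noncomputable def uniformDist (n k : ℕ) : Fin n → ℝ :=
  fun i => if n ≤ (i : ℕ) + k then 1 / (k : ℝ) else 0

/-- The factor `α / (α - 1)` for an order `α > 1`, with its limit `1` at `α = ∞`. -/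
noncomputable def orderRatio (α : ℝ≥0∞) : ℝ :=
  if α = ∞ then 1 else α.toReal / (α.toReal - 1)

/-- The lower bound on the entropy of order `α₂` over all finite probability vectors whose entropy
of order `α₁` equals `h`. -/
noncomputable def entropyLowerBound (α₁ α₂ : ℝ≥0∞) (h : ℝ) : ℝ :=
  if α₁ ≤ 1 then 0
  else orderRatio α₂ * ((α₁.toReal - 1) / α₁.toReal) * h

/-! For finite order `a > 0`, Rényi entropy is a strictly decreasing function of the sum of
`powerKernel a` over the coordinates (`renyiEntropy_le_iff`), and this kernel is strictly convex on
both sides of `a = 1`. Part (a) thus becomes the maximization of one separable convex sum with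
another held fixed.

The optimum is a spike: one coordinate `x` and `m` coordinates `y = (1 - x) / m ≤ x`, found by the
intermediate value theorem between the point mass and the uniform vector. With tangents taken at
`y`, some multiple `l` of the order-`a` tangent gap dominates the order-`b` gap on `[0, x]`, with
equality at `y` and `x` (`exists_tangentGap_le`). No competitor has a coordinate above `x`
(`le_of_sum_powerKernel_eq_spikeDist`), so the inequality can be summed over its coordinates; this
settles finite order, and the coordinate bound alone settles order `∞`.

In (b), positive entropy keeps every coordinate below 1, which gives positivity. For `α₁ > 1`, the
strict bound comes from comparing each coordinate with the `ℓ^a` norm (`lt_rpow_sum_rpow`). Spikes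
of fixed `α₁`-entropy with `m → ∞` approach the bound: the small coordinates stop contributing at
larger orders, and the limit of `x` gives the value. -/

/-! ### Convexity and tangent lines -/

theorem strictConvexOn_of_hasDerivAt2_pos {D : Set ℝ} (hD : Convex ℝ D) {f f' f'' : ℝ → ℝ}
    (hf : ContinuousOn f D) (hf' : ∀ x ∈ interior D, HasDerivAt f (f' x) x)
    (hf'' : ∀ x ∈ interior D, HasDerivAt f' (f'' x) x) (hpos : ∀ x ∈ interior D, 0 < f'' x) :
    StrictConvexOn ℝ D f := by
  refine strictConvexOn_of_deriv2_pos hD hf fun x hx => ?_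
  have he : deriv f =ᶠ[nhds x] f' :=
    Filter.eventually_of_mem (isOpen_interior.mem_nhds hx) fun z hz => (hf' z hz).deriv
  have : deriv^[2] f x = f'' x := by
    simp only [Function.iterate_succ, Function.iterate_zero, Function.comp, id]
    rw [he.deriv_eq, (hf'' x hx).deriv]
  rw [this]
  exact hpos x hx

theorem ConvexOn.tangent_le {s : Set ℝ} {f : ℝ → ℝ} {f' x t : ℝ} (hf : ConvexOn ℝ s f)
    (hx : x ∈ s) (ht : t ∈ s) (h : HasDerivAt f f' x) : f x + f' * (t - x) ≤ f t := by
  rcases lt_trichotomy x t with hxt | rfl | hxt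
  · have := hf.le_slope_of_hasDerivAt hx ht hxt h
    rw [slope_def_field, le_div_iff₀ (by linarith)] at this
    linarith
  · simp
  · have := hf.slope_le_of_hasDerivAt ht hx hxt h
    rw [slope_def_field, div_le_iff₀ (by linarith)] at this
    linarith

theorem StrictConvexOn.tangent_lt {s : Set ℝ} {f : ℝ → ℝ} {f' x t : ℝ}
    (hf : StrictConvexOn ℝ s f) (hx : x ∈ s) (ht : t ∈ s) (hne : t ≠ x) (h : HasDerivAt f f' x) :
    f x + f' * (t - x) < f t := by
  rcases lt_or_gt_of_ne hne with hxt | hxt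
  · have := hf.slope_lt_of_hasDerivAt ht hx hxt h
    rw [slope_def_field, div_lt_iff₀ (by linarith)] at this
    linarith
  · have := hf.lt_slope_of_hasDerivAt hx ht hxt h
    rw [slope_def_field, lt_div_iff₀ (by linarith)] at this
    linarith

/-! ### Power kernels and their differences -/

/-- The convex function `t ^ a / (a * (a - 1))`, read as `t * log t` at `a = 1`; its second
derivative is `t ^ (a - 2)`. -/
noncomputable def powerKernel (a t : ℝ) : ℝ :=
  if a = 1 then t * Real.log t else t ^ a / (a * (a - 1))

/-- The derivative of `powerKernel a`. -/
noncomputable def powerKernelDeriv (a t : ℝ) : ℝ :=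
  if a = 1 then Real.log t + 1 else t ^ (a - 1) / (a - 1)

theorem powerKernel_zero {a : ℝ} (ha : 0 < a) : powerKernel a 0 = 0 := by
  unfold powerKernel
  split_ifs <;> simp [Real.zero_rpow ha.ne']

theorem continuous_powerKernel {a : ℝ} (ha : 0 < a) : Continuous (powerKernel a) := by
  unfold powerKernel
  by_cases h : a = 1
  · simpa [h] using Real.continuous_mul_log
  · simpa [h] using (Real.continuous_rpow_const ha.le).div_const _

theorem hasDerivAt_powerKernel {a t : ℝ} (ha : 0 < a) (ht : 0 < t) :
    HasDerivAt (powerKernel a) (powerKernelDeriv a t) t := by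
  unfold powerKernel powerKernelDeriv
  by_cases h : a = 1
  · simpa [h] using Real.hasDerivAt_mul_log ht.ne'
  · simp only [h, if_false]
    have h1 : a - 1 ≠ 0 := sub_ne_zero.2 h
    refine ((Real.hasDerivAt_rpow_const (p := a) (Or.inl ht.ne')).div_const
      (a * (a - 1))).congr_deriv ?_
    field_simp

theorem hasDerivAt_powerKernelDeriv {a t : ℝ} (ht : 0 < t) :
    HasDerivAt (powerKernelDeriv a) (t ^ (a - 2)) t := by
  unfold powerKernelDeriv
  by_cases h : a = 1
  · subst h
    simp only [if_true]
    refine ((Real.hasDerivAt_log ht.ne').add_const 1).congr_deriv ?_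
    rw [show (1 : ℝ) - 2 = -1 by norm_num, Real.rpow_neg_one]
  · simp only [h, if_false]
    have h1 : a - 1 ≠ 0 := sub_ne_zero.2 h
    refine ((Real.hasDerivAt_rpow_const (p := a - 1) (Or.inl ht.ne')).div_const
      (a - 1)).congr_deriv ?_
    rw [show a - 1 - 1 = a - 2 by ring]
    field_simp

theorem strictConvexOn_powerKernel {a : ℝ} (ha : 0 < a) :
    StrictConvexOn ℝ (Set.Ici 0) (powerKernel a) := by
  refine strictConvexOn_of_hasDerivAt2_pos (f' := powerKernelDeriv a)
    (f'' := fun t => t ^ (a - 2)) (convex_Ici 0)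
    (continuous_powerKernel ha).continuousOn ?_ ?_ ?_ <;> intro t ht <;>
    rw [interior_Ici, Set.mem_Ioi] at ht
  · exact hasDerivAt_powerKernel ha ht
  · exact hasDerivAt_powerKernelDeriv ht
  · exact Real.rpow_pos_of_pos ht _

theorem powerKernel_le_mul {a t : ℝ} (ha : 0 < a) (h0 : 0 ≤ t) (h1 : t ≤ 1) :
    powerKernel a t ≤ t * powerKernel a 1 := by
  have := (strictConvexOn_powerKernel ha).convexOn.2 (x := 0) (y := 1) (by simp) (by simp)
    (sub_nonneg.2 h1) h0 (by ring)
  simpa [powerKernel_zero ha] using this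

theorem powerKernel_lt_mul {a t : ℝ} (ha : 0 < a) (h0 : 0 < t) (h1 : t < 1) :
    powerKernel a t < t * powerKernel a 1 := by
  have := (strictConvexOn_powerKernel ha).2 (x := 0) (y := 1) (by simp) (by simp) (by simp)
    (sub_pos.2 h1) h0 (by ring)
  simpa [powerKernel_zero ha] using this

theorem hasDerivAt_powerKernel_sub {a b l t : ℝ} (ha : 0 < a) (hb : 0 < b) (ht : 0 < t) :
    HasDerivAt (fun t => powerKernel b t - l * powerKernel a t)
      (powerKernelDeriv b t - l * powerKernelDeriv a t) t :=
  (hasDerivAt_powerKernel hb ht).sub ((hasDerivAt_powerKernel ha ht).const_mul l)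

theorem hasDerivAt_powerKernelDeriv_sub {a b l t : ℝ} (ht : 0 < t) :
    HasDerivAt (fun t => powerKernelDeriv b t - l * powerKernelDeriv a t)
      (t ^ (a - 2) * (t ^ (b - a) - l)) t := by
  refine ((hasDerivAt_powerKernelDeriv (a := b) ht).sub
    ((hasDerivAt_powerKernelDeriv (a := a) ht).const_mul l)).congr_deriv ?_
  rw [mul_sub, ← Real.rpow_add ht]
  ring_nf

/-- The second derivative is `t ^ (a - 2) * (t ^ (b - a) - c ^ (b - a))`, which changes sign exactly
at `c`; the next lemma is the other side. -/
theorem strictConvexOn_powerKernel_sub {a b c : ℝ} (ha : 0 < a) (hab : a < b) (hc : 0 < c) :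
    StrictConvexOn ℝ (Set.Ici c) (fun t => powerKernel b t - c ^ (b - a) * powerKernel a t) := by
  have hb := ha.trans hab
  refine strictConvexOn_of_hasDerivAt2_pos
    (f' := fun t => powerKernelDeriv b t - c ^ (b - a) * powerKernelDeriv a t)
    (f'' := fun t => t ^ (a - 2) * (t ^ (b - a) - c ^ (b - a))) (convex_Ici c)
    ((continuous_powerKernel hb).sub
      (continuous_const.mul (continuous_powerKernel ha))).continuousOn ?_ ?_ ?_ <;>
    intro t ht <;> rw [interior_Ici, Set.mem_Ioi] at ht
  · exact hasDerivAt_powerKernel_sub ha hb (hc.trans ht)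
  · exact hasDerivAt_powerKernelDeriv_sub (hc.trans ht)
  · exact mul_pos (Real.rpow_pos_of_pos (hc.trans ht) _)
      (sub_pos.2 (Real.rpow_lt_rpow hc.le ht (by linarith)))

theorem convexOn_neg_powerKernel_sub {a b c : ℝ} (ha : 0 < a) (hab : a < b) :
    ConvexOn ℝ (Set.Icc 0 c)
      (fun t => -(powerKernel b t - c ^ (b - a) * powerKernel a t)) := by
  have hb := ha.trans hab
  refine (strictConvexOn_of_hasDerivAt2_pos
    (f' := fun t => -(powerKernelDeriv b t - c ^ (b - a) * powerKernelDeriv a t))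
    (f'' := fun t => -(t ^ (a - 2) * (t ^ (b - a) - c ^ (b - a)))) (convex_Icc 0 c)
    ((continuous_powerKernel hb).sub
      (continuous_const.mul (continuous_powerKernel ha))).neg.continuousOn ?_ ?_ ?_).convexOn <;>
    intro t ht <;> rw [interior_Icc, Set.mem_Ioo] at ht
  · exact (hasDerivAt_powerKernel_sub ha hb ht.1).neg
  · exact (hasDerivAt_powerKernelDeriv_sub ht.1).neg
  · exact neg_pos.2 (mul_neg_of_pos_of_neg (Real.rpow_pos_of_pos ht.1 _)
      (sub_neg.2 (Real.rpow_lt_rpow ht.1.le ht.2 (by linarith))))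

/-! ### Comparison of tangent gaps -/

/-- The gap between `powerKernel a` and its tangent at `y`. -/
noncomputable def tangentGap (a y t : ℝ) : ℝ :=
  powerKernel a t - powerKernel a y - powerKernelDeriv a y * (t - y)

theorem tangentGap_pos {a y t : ℝ} (ha : 0 < a) (hy : 0 < y) (ht : 0 ≤ t) (hne : t ≠ y) :
    0 < tangentGap a y t := by
  have := (strictConvexOn_powerKernel ha).tangent_lt hy.le ht hne (hasDerivAt_powerKernel ha hy)
  unfold tangentGap
  linarith

theorem tangentGap_nonneg {a y t : ℝ} (ha : 0 < a) (hy : 0 < y) (ht : 0 ≤ t) :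
    0 ≤ tangentGap a y t := by
  have := (strictConvexOn_powerKernel ha).convexOn.tangent_le hy.le ht
    (hasDerivAt_powerKernel ha hy)
  unfold tangentGap
  linarith

/-- The difference `D` of the two sides has a double zero at `y`, and `l` is chosen so that `D x =
0`. It is concave up to an inflection point `c ≥ y` and convex beyond: on `[0, c]` it lies below its
zero tangent at `y`, and on `[c, x]` below the larger of its end values. -/
theorem exists_tangentGap_le {a b x y : ℝ} (ha : 0 < a) (hab : a < b) (hy : 0 < y) (hyx : y ≤ x) :
    ∃ l, tangentGap b y x = l * tangentGap a y x ∧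
      ∀ t, 0 ≤ t → t ≤ x → tangentGap b y t ≤ l * tangentGap a y t := by
  have hb := ha.trans hab
  have below : ∀ c, y ≤ c → ∀ t, 0 ≤ t → t ≤ c →
      tangentGap b y t ≤ c ^ (b - a) * tangentGap a y t := by
    intro c hyc t h0 htc
    have := (convexOn_neg_powerKernel_sub (c := c) ha hab).tangent_le (x := y) (t := t)
      ⟨hy.le, hyc⟩ ⟨h0, htc⟩ (hasDerivAt_powerKernel_sub ha hb hy).neg
    unfold tangentGap
    linarith
  rcases hyx.eq_or_lt with rfl | hlt
  -- Both gaps vanish at `x = y`, so their ratio cannot define `l`; the inflection is placed at `y`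
  -- itself.
  · exact ⟨y ^ (b - a), by simp [tangentGap], below y le_rfl⟩
  have hx := hy.trans hlt
  have hA := tangentGap_pos ha hy hx.le hlt.ne'
  have hB := tangentGap_pos hb hy hx.le hlt.ne'
  set l := tangentGap b y x / tangentGap a y x with hl
  have hlpos : 0 < l := div_pos hB hA
  have hlx : tangentGap b y x = l * tangentGap a y x := by rw [hl]; field_simp
  have hba : b - a ≠ 0 := (sub_pos.2 hab).ne'
  -- The inflection point of the difference: `c ^ (b - a) = l`.
  set c := l ^ (b - a)⁻¹ with hc
  have hcpos : 0 < c := Real.rpow_pos_of_pos hlpos _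
  have hcl : c ^ (b - a) = l := by
    rw [hc, ← Real.rpow_mul hlpos.le, inv_mul_cancel₀ hba, Real.rpow_one]
  have hyc : y ≤ c := by
    -- If `c < y`, strict convexity on `[c, ∞)` puts the difference strictly above its zero tangent,
    -- contradicting its vanishing at `x`.
    by_contra! hcy
    have := (strictConvexOn_powerKernel_sub ha hab hcpos).tangent_lt (x := y) (t := x)
      hcy.le (hcy.trans hlt).le hlt.ne' (hasDerivAt_powerKernel_sub ha hb hy)
    rw [hcl] at this
    unfold tangentGap at hlx
    linarith
  refine ⟨l, hlx, fun t h0 htx => ?_⟩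
  rcases le_total t c with htc | hct
  · exact hcl ▸ below c hyc t h0 htc
  have hcx := hct.trans htx
  have hconv : ConvexOn ℝ (Set.Ici c) (fun t => tangentGap b y t - l * tangentGap a y t) := by
    have h1 := (strictConvexOn_powerKernel_sub ha hab hcpos).convexOn
    rw [hcl] at h1
    -- The gap difference is the kernel difference plus an affine function.
    have h2 : ConvexOn ℝ (Set.Ici c) (fun t : ℝ =>
        (-(powerKernelDeriv b y - l * powerKernelDeriv a y)) • t) :=
      ⟨convex_Ici c, fun u _ v _ p q _ _ _ => by simp only [smul_eq_mul]; linarith⟩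
    refine ((h1.add h2).add (convexOn_const (-(powerKernel b y - l * powerKernel a y) +
      (powerKernelDeriv b y - l * powerKernelDeriv a y) * y) (convex_Ici c))).congr fun u _ => ?_
    simp only [tangentGap, Pi.add_apply, smul_eq_mul]
    ring
  have hmax := hconv.le_max_of_mem_Icc (x := c) (y := x) (z := t) (by simp) hcx ⟨hct, htx⟩
  have hcc := below c hyc c hcpos.le le_rfl
  rw [hcl] at hcc
  have : max (tangentGap b y c - l * tangentGap a y c) (tangentGap b y x - l * tangentGap a y x)
      ≤ 0 := max_le (by linarith) (by linarith)
  linarith [hmax.trans this]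

/-! ### Rényi entropy through kernel sums -/

theorem sum_rpow_pos {n : ℕ} {p : Fin n → ℝ} (hp : p ∈ stdSimplex ℝ (Fin n)) (a : ℝ) :
    0 < ∑ i, p i ^ a := by
  obtain ⟨i, -, hi⟩ : ∃ i ∈ Finset.univ, 0 < p i := by
    by_contra! h
    have := Finset.sum_nonpos h
    linarith [hp.2]
  exact Finset.sum_pos' (fun j _ => Real.rpow_nonneg (hp.1 j) a)
    ⟨i, Finset.mem_univ i, Real.rpow_pos_of_pos hi a⟩

theorem sum_powerKernel {n : ℕ} {a : ℝ} (h : a ≠ 1) (p : Fin n → ℝ) :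
    ∑ i, powerKernel a (p i) = (∑ i, p i ^ a) / (a * (a - 1)) := by
  simp [powerKernel, h, Finset.sum_div]

theorem renyiEntropy_one {n : ℕ} (p : Fin n → ℝ) :
    renyiEntropy 1 p = -∑ i, p i * Real.log (p i) := by
  simp [renyiEntropy]

theorem renyiEntropy_top {n : ℕ} (p : Fin n → ℝ) :
    renyiEntropy ∞ p = -Real.log (⨆ i, p i) := by
  simp [renyiEntropy]

theorem renyiEntropy_of_ne {n : ℕ} {α : ℝ≥0∞} (h0 : α ≠ 0) (h1 : α ≠ 1) (ht : α ≠ ∞)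
    (p : Fin n → ℝ) :
    renyiEntropy α p = 1 / (1 - α.toReal) * Real.log (∑ i, p i ^ α.toReal) := by
  simp [renyiEntropy, h0, h1, ht]

theorem toReal_ne_one {α : ℝ≥0∞} (h1 : α ≠ 1) : α.toReal ≠ 1 := by
  simpa [ENNReal.toReal_eq_one_iff] using h1

/-- The factor `a * (a - 1)` in the kernel changes sign at 1 together with `1 / (1 - a)`, so one
monotonicity direction serves all finite orders. -/
theorem renyiEntropy_le_iff {n m : ℕ} {α : ℝ≥0∞} (h0 : α ≠ 0) (ht : α ≠ ∞)
    {p : Fin n → ℝ} {q : Fin m → ℝ} (hp : p ∈ stdSimplex ℝ (Fin n))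
    (hq : q ∈ stdSimplex ℝ (Fin m)) :
    renyiEntropy α p ≤ renyiEntropy α q ↔
      ∑ i, powerKernel α.toReal (q i) ≤ ∑ i, powerKernel α.toReal (p i) := by
  by_cases h1 : α = 1
  · subst h1
    simp [renyiEntropy_one, powerKernel]
  have ha := ENNReal.toReal_pos h0 ht
  have ha1 := toReal_ne_one h1
  have hlog := Real.log_le_log_iff (sum_rpow_pos hp α.toReal) (sum_rpow_pos hq α.toReal)
  have hlog' := Real.log_le_log_iff (sum_rpow_pos hq α.toReal) (sum_rpow_pos hp α.toReal)
  rw [renyiEntropy_of_ne h0 h1 ht, renyiEntropy_of_ne h0 h1 ht, sum_powerKernel ha1,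
    sum_powerKernel ha1]
  rcases lt_or_gt_of_ne ha1 with h | h
  · rw [mul_le_mul_iff_right₀ (by simpa using h), hlog,
      div_le_div_right_of_neg (mul_neg_of_pos_of_neg ha (by linarith))]
  · rw [mul_le_mul_left_of_neg (by simpa using h), hlog',
      div_le_div_iff_of_pos_right (mul_pos ha (by linarith))]

theorem renyiEntropy_lt_iff {n m : ℕ} {α : ℝ≥0∞} (h0 : α ≠ 0) (ht : α ≠ ∞)
    {p : Fin n → ℝ} {q : Fin m → ℝ} (hp : p ∈ stdSimplex ℝ (Fin n))
    (hq : q ∈ stdSimplex ℝ (Fin m)) :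
    renyiEntropy α p < renyiEntropy α q ↔
      ∑ i, powerKernel α.toReal (q i) < ∑ i, powerKernel α.toReal (p i) := by
  rw [← not_le, ← not_le, renyiEntropy_le_iff h0 ht hq hp]

theorem le_iSup_fin {n : ℕ} (p : Fin n → ℝ) (i : Fin n) : p i ≤ ⨆ j, p j :=
  le_ciSup (Set.finite_range p).bddAbove i

theorem iSup_pos_of_mem_stdSimplex {n : ℕ} {p : Fin n → ℝ} (hp : p ∈ stdSimplex ℝ (Fin n)) :
    0 < ⨆ j, p j := by
  by_contra! h
  have := Finset.sum_nonpos fun i (_ : i ∈ Finset.univ) => (le_iSup_fin p i).trans h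
  linarith [hp.2]

theorem nonempty_of_mem_stdSimplex {n : ℕ} {p : Fin n → ℝ} (hp : p ∈ stdSimplex ℝ (Fin n)) :
    Nonempty (Fin n) := by
  by_contra h
  rw [not_nonempty_iff] at h
  simpa using hp.2

theorem renyiEntropy_single {n : ℕ} {α : ℝ≥0∞} (h0 : α ≠ 0) (i : Fin n) :
    renyiEntropy α (Pi.single i (1 : ℝ)) = 0 := by
  by_cases h1 : α = 1
  · subst h1
    rw [renyiEntropy_one, neg_eq_zero]
    refine Finset.sum_eq_zero fun j _ => ?_
    by_cases h : j = i
    · subst h; simp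
    · simp [h]
  by_cases ht : α = ∞
  · subst ht
    have : (⨆ j, (Pi.single i (1 : ℝ) : Fin n → ℝ) j) = 1 := by
      have : Nonempty (Fin n) := ⟨i⟩
      refine le_antisymm (ciSup_le fun j => ?_) (by simpa using le_iSup_fin (Pi.single i 1) i)
      by_cases h : j = i
      · subst h; simp
      · simp [h]
    rw [renyiEntropy_top, this, Real.log_one, neg_zero]
  · have ha := ENNReal.toReal_pos h0 ht
    rw [renyiEntropy_of_ne h0 h1 ht, Finset.sum_eq_single i]
    · simp
    · intro j _ h
      simp [h, Real.zero_rpow ha.ne']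
    · simp

theorem eq_single_of_one_le {n : ℕ} {p : Fin n → ℝ} (hp : p ∈ stdSimplex ℝ (Fin n)) {i : Fin n}
    (hi : 1 ≤ p i) : p = Pi.single i 1 := by
  have hs := Finset.add_sum_erase Finset.univ p (Finset.mem_univ i)
  rw [hp.2] at hs
  have hnn := Finset.sum_nonneg fun j (_ : j ∈ Finset.univ.erase i) => hp.1 j
  have h0 := (Finset.sum_eq_zero_iff_of_nonneg fun j (_ : j ∈ Finset.univ.erase i) => hp.1 j).1
    (by linarith)
  funext j
  by_cases h : j = i
  · subst h; rw [Pi.single_eq_same]; linarith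
  · rw [Pi.single_eq_of_ne h]
    exact h0 j (by simp [h])

theorem renyiEntropy_pos {n : ℕ} {α : ℝ≥0∞} (h0 : α ≠ 0) {p : Fin n → ℝ}
    (hp : p ∈ stdSimplex ℝ (Fin n)) (h : ∀ i, p i < 1) : 0 < renyiEntropy α p := by
  have := nonempty_of_mem_stdSimplex hp
  by_cases ht : α = ∞
  · subst ht
    obtain ⟨i, hi⟩ := exists_eq_ciSup_of_finite (f := p)
    rw [renyiEntropy_top, neg_pos]
    exact Real.log_neg (iSup_pos_of_mem_stdSimplex hp) (hi ▸ h i)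
  have ha := ENNReal.toReal_pos h0 ht
  obtain ⟨i⟩ := this
  rw [← renyiEntropy_single h0 i, renyiEntropy_lt_iff h0 ht (single_mem_stdSimplex ℝ i) hp]
  have h1 : ∑ j, powerKernel α.toReal ((Pi.single i (1 : ℝ) : Fin n → ℝ) j)
      = powerKernel α.toReal 1 := by
    rw [Finset.sum_eq_single i]
    · simp
    · intro j _ hj
      simp [hj, powerKernel_zero ha]
    · simp
  have h2 : powerKernel α.toReal 1 = ∑ j, p j * powerKernel α.toReal 1 := by
    rw [← Finset.sum_mul, hp.2, one_mul]
  rw [h1, h2]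
  obtain ⟨k, -, hk⟩ : ∃ k ∈ Finset.univ, 0 < p k := by
    by_contra! h
    have := Finset.sum_nonpos h
    linarith [hp.2]
  exact Finset.sum_lt_sum (fun j _ => powerKernel_le_mul ha (hp.1 j) (h j).le)
    ⟨k, Finset.mem_univ k, powerKernel_lt_mul ha hk (h k)⟩

theorem renyiEntropy_nonneg {n : ℕ} {α : ℝ≥0∞} (h0 : α ≠ 0) {p : Fin n → ℝ}
    (hp : p ∈ stdSimplex ℝ (Fin n)) : 0 ≤ renyiEntropy α p := by
  by_cases h : ∀ i, p i < 1
  · exact (renyiEntropy_pos h0 hp h).le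
  · push Not at h
    obtain ⟨i, hi⟩ := h
    rw [eq_single_of_one_le hp hi, renyiEntropy_single h0]

theorem lt_one_of_renyiEntropy_pos {n : ℕ} {α : ℝ≥0∞} (h0 : α ≠ 0) {p : Fin n → ℝ}
    (hp : p ∈ stdSimplex ℝ (Fin n)) (h : 0 < renyiEntropy α p) (i : Fin n) : p i < 1 := by
  by_contra! hi
  rw [eq_single_of_one_le hp hi, renyiEntropy_single h0] at h
  exact h.false

/-! ### Spiked distributions -/

/-- The distribution with mass `x` at the last of `m + 1` points, uniform on the others. -/
noncomputable def spikeDist (m : ℕ) (x : ℝ) : Fin (m + 1) → ℝ :=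
  fun i => if i = Fin.last m then x else (1 - x) / m

theorem sum_spikeDist (m : ℕ) (x : ℝ) (f : ℝ → ℝ) :
    ∑ i, f (spikeDist m x i) = m * f ((1 - x) / m) + f x := by
  rw [Fin.sum_univ_castSucc]
  simp [spikeDist, (Fin.castSucc_lt_last _).ne]

theorem spikeDist_mem {m : ℕ} (hm : m ≠ 0) {x : ℝ} (h0 : 0 ≤ x) (h1 : x ≤ 1) :
    spikeDist m x ∈ stdSimplex ℝ (Fin (m + 1)) := by
  refine ⟨fun i => ?_, ?_⟩
  · unfold spikeDist
    split_ifs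
    · exact h0
    · exact div_nonneg (by linarith) (by positivity)
  · have := sum_spikeDist m x id
    simp only [id] at this
    rw [this]
    field_simp
    ring

theorem spikeDist_one (m : ℕ) : spikeDist m 1 = Pi.single (Fin.last m) 1 := by
  funext i
  simp [spikeDist, Pi.single_apply]

theorem spikeDist_uniform {m : ℕ} (hm : m ≠ 0) :
    spikeDist m (1 / (m + 1 : ℝ)) = fun _ => 1 / (m + 1 : ℝ) := by
  funext i
  unfold spikeDist
  split_ifs
  · rfl
  · field_simp
    ring

theorem renyiEntropy_uniform {m : ℕ} {α : ℝ≥0∞} (h0 : α ≠ 0) (ht : α ≠ ∞) :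
    renyiEntropy α (fun _ : Fin (m + 1) => 1 / (m + 1 : ℝ)) = Real.log (m + 1) := by
  have hm : (0 : ℝ) < m + 1 := by positivity
  by_cases h1 : α = 1
  · subst h1
    rw [renyiEntropy_one]
    simp
    field_simp
  · have h2 : 1 - α.toReal ≠ 0 := sub_ne_zero.2 (toReal_ne_one h1).symm
    rw [renyiEntropy_of_ne h0 h1 ht, Finset.sum_const, Finset.card_univ, Fintype.card_fin,
      nsmul_eq_mul, Real.log_mul (by positivity) (by positivity), Real.log_rpow (by positivity),
      one_div (m + 1 : ℝ), Real.log_inv]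
    push_cast
    field_simp
    ring

theorem renyiEntropy_le_log {m : ℕ} {α : ℝ≥0∞} (h0 : α ≠ 0) (ht : α ≠ ∞)
    {p : Fin (m + 1) → ℝ} (hp : p ∈ stdSimplex ℝ (Fin (m + 1))) :
    renyiEntropy α p ≤ Real.log (m + 1) := by
  have ha := ENNReal.toReal_pos h0 ht
  have hu : (0 : ℝ) < 1 / (m + 1) := by positivity
  have hmem : (fun _ => 1 / (m + 1 : ℝ)) ∈ stdSimplex ℝ (Fin (m + 1)) :=
    ⟨fun _ => hu.le, by simp; field_simp⟩
  rw [← renyiEntropy_uniform h0 ht, renyiEntropy_le_iff h0 ht hp hmem]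
  -- Jensen's inequality: the linear tangent terms cancel because both vectors have total mass 1.
  have := Finset.sum_nonneg fun i (_ : i ∈ Finset.univ) => tangentGap_nonneg ha hu (hp.1 i)
  simp only [tangentGap, Finset.sum_sub_distrib, ← Finset.mul_sum, hp.2] at this
  rw [← Finset.sum_sub_distrib] at this
  simp only [Finset.sum_sub_distrib, hmem.2] at this
  linarith

theorem continuousOn_renyiEntropy_spikeDist {m : ℕ} (hm : m ≠ 0) {α : ℝ≥0∞} (h0 : α ≠ 0)
    (ht : α ≠ ∞) :
    ContinuousOn (fun x => renyiEntropy α (spikeDist m x)) (Set.Icc 0 1) := by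
  have ha := ENNReal.toReal_pos h0 ht
  by_cases h1 : α = 1
  · subst h1
    have : (fun x => renyiEntropy 1 (spikeDist m x)) = fun x : ℝ =>
        -(m * ((1 - x) / m * Real.log ((1 - x) / m)) + x * Real.log x) := by
      funext x
      rw [renyiEntropy_one, sum_spikeDist m x fun t => t * Real.log t]
    rw [this]
    have hc := Real.continuous_mul_log
    exact (((hc.comp (f := fun x : ℝ => (1 - x) / m) (by fun_prop)).const_mul _).add
      hc).neg.continuousOn
  · have : (fun x => renyiEntropy α (spikeDist m x)) = fun x : ℝ =>
        1 / (1 - α.toReal) * Real.log (∑ i, spikeDist m x i ^ α.toReal) := by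
      funext x
      rw [renyiEntropy_of_ne h0 h1 ht]
    rw [this]
    refine ContinuousOn.mul continuousOn_const (ContinuousOn.log ?_ fun x hx =>
      (sum_rpow_pos (spikeDist_mem hm hx.1 hx.2) _).ne')
    have hs : (fun x => ∑ i, spikeDist m x i ^ α.toReal) = fun x : ℝ =>
        m * ((1 - x) / m) ^ α.toReal + x ^ α.toReal := by
      funext x
      rw [sum_spikeDist m x fun t => t ^ α.toReal]
    rw [hs]
    have hc := Real.continuous_rpow_const ha.le
    exact (((hc.comp (f := fun x : ℝ => (1 - x) / m) (by fun_prop)).const_mul _).add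
      hc).continuousOn

theorem exists_renyiEntropy_spikeDist_eq {m : ℕ} (hm : m ≠ 0) {α : ℝ≥0∞} (h0 : α ≠ 0)
    (ht : α ≠ ∞) {h : ℝ} (hh : 0 ≤ h) (hlog : h ≤ Real.log (m + 1)) :
    ∃ x ∈ Set.Icc (1 / (m + 1 : ℝ)) 1, renyiEntropy α (spikeDist m x) = h := by
  have hu : (0 : ℝ) < 1 / (m + 1) := by positivity
  have hu1 : 1 / (m + 1 : ℝ) ≤ 1 := by
    rw [div_le_one (by positivity)]
    linarith [(Nat.cast_nonneg m : (0 : ℝ) ≤ m)]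
  obtain ⟨x, hx, hxh⟩ := intermediate_value_Icc' hu1
    ((continuousOn_renyiEntropy_spikeDist hm h0 ht).mono (Set.Icc_subset_Icc_left hu.le))
    (show h ∈ Set.Icc _ _ by
      rw [spikeDist_one, renyiEntropy_single h0, spikeDist_uniform hm, renyiEntropy_uniform h0 ht]
      exact ⟨hh, hlog⟩)
  exact ⟨x, hx, hxh⟩

/-! ### Minimality of spikes -/

/-- Suppose `R k > x`. Bounding the kernel below by its tangent at `x` for coordinate `k` and at `y`
for the others, the kernel sum exceeds that of the spike by more than `(φ' x - φ' y) * (R k - x) ≥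
0`, where `φ` is the kernel. -/
theorem le_of_sum_powerKernel_eq_spikeDist {m : ℕ} {a x : ℝ} (ha : 0 < a)
    (hy : 0 < (1 - x) / m) (hyx : (1 - x) / m ≤ x) {R : Fin (m + 1) → ℝ}
    (hR : R ∈ stdSimplex ℝ (Fin (m + 1)))
    (h : ∑ i, powerKernel a (R i) = ∑ i, powerKernel a (spikeDist m x i)) (k : Fin (m + 1)) :
    R k ≤ x := by
  by_contra! hk
  have hm : (m : ℝ) ≠ 0 := by
    rintro h0
    simp [h0] at hy
  set y := (1 - x) / m with hydef
  have hmy : m * y = 1 - x := by rw [hydef]; field_simp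
  have hx := hy.trans_le hyx
  have hconv := strictConvexOn_powerKernel ha
  have hderiv : powerKernelDeriv a y ≤ powerKernelDeriv a x := by
    rcases hyx.eq_or_lt with he | hlt
    · rw [← he]
    · have h1 := hconv.tangent_lt hy.le hx.le hlt.ne' (hasDerivAt_powerKernel ha hy)
      have h2 := hconv.tangent_lt hx.le hy.le hlt.ne (hasDerivAt_powerKernel ha hx)
      by_contra! h3
      nlinarith
  rw [sum_spikeDist, ← Finset.add_sum_erase _ _ (Finset.mem_univ k)] at h
  have hsum := hR.2
  rw [← Finset.add_sum_erase _ _ (Finset.mem_univ k)] at hsum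
  have h1 := hconv.tangent_lt hx.le (hR.1 k) hk.ne' (hasDerivAt_powerKernel ha hx)
  have h2 := Finset.sum_le_sum fun i (_ : i ∈ Finset.univ.erase k) =>
    hconv.convexOn.tangent_le hy.le (hR.1 i) (hasDerivAt_powerKernel ha hy)
  rw [Finset.sum_add_distrib, ← Finset.mul_sum, Finset.sum_sub_distrib, Finset.sum_const,
    Finset.sum_const, Finset.card_erase_of_mem (Finset.mem_univ k), Finset.card_univ,
    Fintype.card_fin, Nat.add_sub_cancel, nsmul_eq_mul, nsmul_eq_mul, hmy,
    show ∑ i ∈ Finset.univ.erase k, R i = 1 - R k by linarith] at h2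
  nlinarith [mul_nonneg (sub_nonneg.2 hderiv) (sub_nonneg.2 hk.le)]

theorem sum_tangentGap {n : ℕ} (a y : ℝ) {p : Fin n → ℝ} (hp : p ∈ stdSimplex ℝ (Fin n)) :
    ∑ i, tangentGap a y (p i) = ∑ i, powerKernel a (p i) -
      (n * powerKernel a y + powerKernelDeriv a y * (1 - n * y)) := by
  simp only [tangentGap, Finset.sum_sub_distrib, ← Finset.mul_sum, hp.2]
  simp
  ring

theorem sum_powerKernel_le_spikeDist {m : ℕ} {a b x : ℝ} (ha : 0 < a) (hab : a < b)
    (hy : 0 < (1 - x) / m) (hyx : (1 - x) / m ≤ x) {R : Fin (m + 1) → ℝ}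
    (hR : R ∈ stdSimplex ℝ (Fin (m + 1))) (hQ : spikeDist m x ∈ stdSimplex ℝ (Fin (m + 1)))
    (h : ∑ i, powerKernel a (R i) = ∑ i, powerKernel a (spikeDist m x i)) :
    ∑ i, powerKernel b (R i) ≤ ∑ i, powerKernel b (spikeDist m x i) := by
  obtain ⟨l, hl, hle⟩ := exists_tangentGap_le ha hab hy hyx
  have h1 := Finset.sum_le_sum fun i (_ : i ∈ Finset.univ) =>
    hle (R i) (hR.1 i) (le_of_sum_powerKernel_eq_spikeDist ha hy hyx hR h i)
  have h2 : ∑ i, tangentGap b ((1 - x) / m) (spikeDist m x i) =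
      ∑ i, l * tangentGap a ((1 - x) / m) (spikeDist m x i) := by
    refine Finset.sum_congr rfl fun i _ => ?_
    unfold spikeDist
    split_ifs
    · exact hl
    · simp [tangentGap]
  rw [← Finset.mul_sum, sum_tangentGap _ _ hR, sum_tangentGap _ _ hR, h] at h1
  rw [← Finset.mul_sum, sum_tangentGap _ _ hQ, sum_tangentGap _ _ hQ] at h2
  linarith

theorem div_le_of_mem_Icc {m : ℕ} {x : ℝ} (hx : x ∈ Set.Icc (1 / (m + 1 : ℝ)) 1) :
    (1 - x) / m ≤ x := by
  have h := hx.1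
  rw [div_le_iff₀ (by positivity)] at h
  rcases Nat.eq_zero_or_pos m with rfl | hm
  · simp at h ⊢
    linarith
  · rw [div_le_iff₀ (by exact_mod_cast hm)]
    linarith

theorem renyiEntropy_spikeDist_le {m : ℕ} (hm : m ≠ 0) {α₁ α₂ : ℝ≥0∞} (h₁ : 0 < α₁)
    (h₁₂ : α₁ < α₂) {x : ℝ} (hx : x ∈ Set.Icc (1 / (m + 1 : ℝ)) 1) {R : Fin (m + 1) → ℝ}
    (hR : R ∈ stdSimplex ℝ (Fin (m + 1)))
    (h : renyiEntropy α₁ R = renyiEntropy α₁ (spikeDist m x)) :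
    renyiEntropy α₂ (spikeDist m x) ≤ renyiEntropy α₂ R := by
  have h2 : α₂ ≠ 0 := (h₁.trans h₁₂).ne'
  have ht : α₁ ≠ ∞ := h₁₂.ne_top
  -- At `x = 1` the small coordinate is 0, where the tangent argument is unavailable; the spike then
  -- has zero entropy.
  rcases hx.2.eq_or_lt with rfl | hx1
  · rw [spikeDist_one, renyiEntropy_single h2]
    exact renyiEntropy_nonneg h2 hR
  have hm0 : (0 : ℝ) < m := by positivity
  have hy : 0 < (1 - x) / m := div_pos (by linarith) hm0
  have hyx := div_le_of_mem_Icc hx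
  have hQ := spikeDist_mem hm (hy.trans_le hyx).le hx.2
  have ha := ENNReal.toReal_pos h₁.ne' ht
  have hΦ : ∑ i, powerKernel α₁.toReal (R i) = ∑ i, powerKernel α₁.toReal (spikeDist m x i) :=
    le_antisymm ((renyiEntropy_le_iff h₁.ne' ht hQ hR).1 h.ge)
      ((renyiEntropy_le_iff h₁.ne' ht hR hQ).1 h.le)
  by_cases ht2 : α₂ = ∞
  · subst ht2
    rw [renyiEntropy_top, renyiEntropy_top, neg_le_neg_iff]
    refine Real.log_le_log (iSup_pos_of_mem_stdSimplex hR) (ciSup_le fun i =>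
      (le_of_sum_powerKernel_eq_spikeDist ha hy hyx hR hΦ i).trans ?_)
    simpa [spikeDist] using le_iSup_fin (spikeDist m x) (Fin.last m)
  · exact (renyiEntropy_le_iff h2 ht2 hQ hR).2 (sum_powerKernel_le_spikeDist ha
      ((ENNReal.toReal_lt_toReal ht ht2).2 h₁₂) hy hyx hR hQ hΦ)

theorem spikeDist_mem_segment {m : ℕ} (hm : m ≠ 0) {x : ℝ}
    (hx : x ∈ Set.Icc (1 / (m + 1 : ℝ)) 1) :
    spikeDist m x ∈ segment ℝ (uniformDist (m + 1) 1) (uniformDist (m + 1) (m + 1)) := by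
  have hm0 : (0 : ℝ) < m := by positivity
  have h := hx.1
  rw [div_le_iff₀ (by positivity)] at h
  refine ⟨((m + 1) * x - 1) / m, (m + 1) * (1 - x) / m, div_nonneg (by linarith) hm0.le,
    div_nonneg (mul_nonneg (by positivity) (by linarith [hx.2])) hm0.le, by field_simp; ring, ?_⟩
  funext i
  have hi : (m + 1 ≤ (i : ℕ) + 1) ↔ i = Fin.last m := by
    rw [Fin.ext_iff, Fin.val_last]
    omega
  simp only [uniformDist, spikeDist, Pi.add_apply, Pi.smul_apply, smul_eq_mul, hi]
  rw [if_pos (by omega : m + 1 ≤ (i : ℕ) + (m + 1))]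
  split_ifs <;> push_cast <;> field_simp <;> ring

theorem exists_mem_segment_renyiEntropy_le (α₁ α₂ : ℝ≥0∞) (h₁ : 0 < α₁) (h₁₂ : α₁ < α₂) (n : ℕ)
    (P : Fin n → ℝ) (hP : P ∈ stdSimplex ℝ (Fin n)) :
    ∃ Q ∈ segment ℝ (uniformDist n 1) (uniformDist n n),
      Q ∈ stdSimplex ℝ (Fin n) ∧ renyiEntropy α₁ Q = renyiEntropy α₁ P ∧
      ∀ R ∈ stdSimplex ℝ (Fin n), renyiEntropy α₁ R = renyiEntropy α₁ P →
        renyiEntropy α₂ Q ≤ renyiEntropy α₂ R := by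
  rcases n with _ | m
  · simpa using hP.2
  -- A spike needs `m ≠ 0`; on one point the simplex is a singleton.
  rcases Nat.eq_zero_or_pos m with rfl | hm
  · have hone : ∀ R ∈ stdSimplex ℝ (Fin 1), R = uniformDist 1 1 := by
      intro R hR
      funext i
      have := hR.2
      rw [Fin.sum_univ_one] at this
      rw [Subsingleton.elim i 0, this]
      simp [uniformDist]
    refine ⟨P, ?_, hP, rfl, fun R hR _ => ?_⟩
    · rw [hone P hP]
      exact left_mem_segment ℝ _ _
    · rw [hone R hR, hone P hP]
  · have ht : α₁ ≠ ∞ := h₁₂.ne_top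
    obtain ⟨x, hx, hxP⟩ := exists_renyiEntropy_spikeDist_eq hm.ne' h₁.ne' ht
      (renyiEntropy_nonneg h₁.ne' hP) (renyiEntropy_le_log h₁.ne' ht hP)
    refine ⟨spikeDist m x, spikeDist_mem_segment hm.ne' hx,
      spikeDist_mem hm.ne' (le_trans (by positivity) hx.1) hx.2, hxP, fun R hR hRP => ?_⟩
    exact renyiEntropy_spikeDist_le hm.ne' h₁ h₁₂ hx hR (hRP.trans hxP.symm)

/-! ### The strict lower bound -/

theorem lt_rpow_sum_rpow {n : ℕ} {a : ℝ} (ha : 0 < a) {p : Fin n → ℝ}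
    (hp : p ∈ stdSimplex ℝ (Fin n)) (h : ∀ i, p i < 1) (i : Fin n) :
    p i < (∑ j, p j ^ a) ^ a⁻¹ := by
  -- A second positive coordinate makes the norm comparison strict.
  obtain ⟨k, hki, hk⟩ : ∃ k ≠ i, 0 < p k := by
    by_contra! hk
    have h1 : ∑ j, p j = p i := Finset.sum_eq_single i
      (fun j _ hj => le_antisymm (hk j hj) (hp.1 j)) (by simp)
    linarith [hp.2, h i]
  have hlt : p i ^ a < ∑ j, p j ^ a := by
    have h1 := Finset.add_sum_erase Finset.univ (fun j => p j ^ a) (Finset.mem_univ i)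
    have h2 := Finset.single_le_sum (s := Finset.univ.erase i) (f := fun j => p j ^ a)
      (fun j _ => Real.rpow_nonneg (hp.1 j) a) (a := k) (by simp [hki])
    have h3 := Real.rpow_pos_of_pos hk a
    linarith
  calc p i = (p i ^ a) ^ a⁻¹ := by rw [← Real.rpow_mul (hp.1 i), mul_inv_cancel₀ ha.ne',
        Real.rpow_one]
    _ < _ := Real.rpow_lt_rpow (Real.rpow_nonneg (hp.1 i) a) hlt (inv_pos.2 ha)

theorem entropyLowerBound_lt_renyiEntropy (α₁ α₂ : ℝ≥0∞) (h₁ : 0 < α₁) (h₁₂ : α₁ < α₂) {h : ℝ}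
    (hh : 0 < h) {n : ℕ} {P : Fin n → ℝ} (hP : P ∈ stdSimplex ℝ (Fin n))
    (hPh : renyiEntropy α₁ P = h) : entropyLowerBound α₁ α₂ h < renyiEntropy α₂ P := by
  have hlt := lt_one_of_renyiEntropy_pos h₁.ne' hP (hPh ▸ hh)
  have h2 : α₂ ≠ 0 := (h₁.trans h₁₂).ne'
  unfold entropyLowerBound
  split_ifs with hle
  · exact renyiEntropy_pos h2 hP hlt
  have h1 : 1 < α₁ := not_le.1 hle
  have ht : α₁ ≠ ∞ := h₁₂.ne_top
  set a := α₁.toReal with ha_def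
  have ha1 : 1 < a := by
    simpa using (ENNReal.toReal_lt_toReal ENNReal.one_ne_top ht).2 h1
  have ha : 0 < a := by linarith
  have hS := sum_rpow_pos hP a
  rw [renyiEntropy_of_ne h₁.ne' h1.ne' ht, ← ha_def] at hPh
  have hNlt := lt_rpow_sum_rpow ha hP hlt
  set S := ∑ i, P i ^ a with hSdef
  have hN : 0 < S ^ a⁻¹ := Real.rpow_pos_of_pos hS _
  have hb : (a - 1) / a * h = -(a⁻¹ * Real.log S) := by
    rw [← hPh]
    have : 1 - a ≠ 0 := by linarith
    field_simp
    ring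
  have := nonempty_of_mem_stdSimplex hP
  by_cases ht2 : α₂ = ∞
  · subst ht2
    obtain ⟨i, hi⟩ := exists_eq_ciSup_of_finite (f := P)
    rw [renyiEntropy_top, orderRatio, if_pos rfl, one_mul, hb, ← Real.log_rpow hS,
      neg_lt_neg_iff]
    exact Real.log_lt_log (iSup_pos_of_mem_stdSimplex hP) (hi ▸ hNlt i)
  set b := α₂.toReal with hb_def
  have hab : a < b := (ENNReal.toReal_lt_toReal ht ht2).2 h₁₂
  -- Split `P i ^ b = P i ^ a * P i ^ (b - a)` and bound the second factor by the `ℓ^a` norm `S ^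
  -- a⁻¹`.
  have hS2 : ∑ i, P i ^ b < S * (S ^ a⁻¹) ^ (b - a) := by
    obtain ⟨k, -, hk⟩ : ∃ k ∈ Finset.univ, 0 < P k := by
      by_contra! h
      have := Finset.sum_nonpos h
      linarith [hP.2]
    have hsplit : ∀ i, P i ^ b = P i ^ a * P i ^ (b - a) := by
      intro i
      rw [← Real.rpow_add_of_nonneg (hP.1 i) ha.le (by linarith)]
      ring_nf
    rw [hSdef, Finset.sum_mul]
    refine Finset.sum_lt_sum (fun i _ => ?_) ⟨k, Finset.mem_univ k, ?_⟩
    · rw [hsplit]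
      exact mul_le_mul_of_nonneg_left (Real.rpow_le_rpow (hP.1 i) (hNlt i).le (by linarith))
        (Real.rpow_nonneg (hP.1 i) _)
    · rw [hsplit]
      exact mul_lt_mul_of_pos_left (Real.rpow_lt_rpow (hP.1 k) (hNlt k) (by linarith))
        (Real.rpow_pos_of_pos hk _)
  have hlog := Real.log_lt_log (sum_rpow_pos hP b) hS2
  rw [Real.log_mul hS.ne' (Real.rpow_pos_of_pos hN _).ne', Real.log_rpow hN, Real.log_rpow hS]
    at hlog
  rw [renyiEntropy_of_ne h2 (h1.trans h₁₂).ne' ht2, orderRatio, if_neg ht2, mul_assoc, hb,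
    ← hb_def]
  have hb1 : 0 < b - 1 := by linarith
  have e1 : b / (b - 1) * -(a⁻¹ * Real.log S) =
      -(Real.log S + (b - a) * (a⁻¹ * Real.log S)) / (b - 1) := by
    field_simp
    ring
  have e2 : 1 / (1 - b) * Real.log (∑ i, P i ^ b) = -Real.log (∑ i, P i ^ b) / (b - 1) := by
    rw [← neg_sub b 1, one_div, inv_neg]
    field_simp
  rw [e1, e2]
  exact div_lt_div_of_pos_right (neg_lt_neg hlog) hb1

/-! ### Tightness by spikes on growing supports -/

/-- The extra factor satisfies `q ^ (b - a) ≤ (1 / m) ^ (b - a) → 0`, while `m * q ^ a` stays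
bounded. -/
theorem tendsto_mul_rpow_zero {a b C : ℝ} (hab : a < b) {q : ℕ → ℝ}
    (hq : ∀ᶠ m : ℕ in Filter.atTop, 0 ≤ q m ∧ q m ≤ 1 / m ∧ m * q m ^ a ≤ C) (ha : 0 < a) :
    Filter.Tendsto (fun m : ℕ => m * q m ^ b) Filter.atTop (nhds 0) := by
  have hlim : Filter.Tendsto (fun m : ℕ => C * (1 / (m : ℝ)) ^ (b - a)) Filter.atTop (nhds 0) := by
    have h1 : Filter.Tendsto (fun m : ℕ => (1 / (m : ℝ)) ^ (b - a)) Filter.atTop (nhds 0) := by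
      have := (tendsto_one_div_atTop_nhds_zero_nat (𝕜 := ℝ)).rpow_const (p := b - a)
        (Or.inr (by linarith))
      rwa [Real.zero_rpow (by linarith)] at this
    simpa using h1.const_mul C
  refine squeeze_zero' ?_ ?_ hlim
  · filter_upwards [hq] with m hm
    exact mul_nonneg (Nat.cast_nonneg m) (Real.rpow_nonneg hm.1 _)
  · filter_upwards [hq] with m hm
    obtain ⟨h0, h1, h2⟩ := hm
    have hsplit : q m ^ b = q m ^ a * q m ^ (b - a) := by
      rw [← Real.rpow_add_of_nonneg h0 ha.le (by linarith)]
      ring_nf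
    rw [hsplit, ← mul_assoc]
    have h3 : 0 ≤ m * q m ^ a := mul_nonneg (Nat.cast_nonneg m) (Real.rpow_nonneg h0 _)
    exact mul_le_mul h2 (Real.rpow_le_rpow h0 h1 (by linarith)) (Real.rpow_nonneg h0 _)
      (h3.trans h2)

/-- At finite order, keep only the `i`-th term of the power sum; the prefactor `1 / (1 - b)` is
negative. -/
theorem renyiEntropy_le_orderRatio_mul {n : ℕ} {α : ℝ≥0∞} (h1 : 1 < α) {p : Fin n → ℝ}
    (hp : p ∈ stdSimplex ℝ (Fin n)) {i : Fin n} (hi : 0 < p i) :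
    renyiEntropy α p ≤ orderRatio α * -Real.log (p i) := by
  by_cases ht : α = ∞
  · subst ht
    rw [renyiEntropy_top, orderRatio, if_pos rfl, one_mul, neg_le_neg_iff]
    exact Real.log_le_log hi (le_iSup_fin p i)
  · have hb : 1 < α.toReal := by
      simpa using (ENNReal.toReal_lt_toReal ENNReal.one_ne_top ht).2 h1
    rw [renyiEntropy_of_ne (zero_lt_one.trans h1).ne' h1.ne' ht, orderRatio, if_neg ht]
    set b := α.toReal
    have hS : p i ^ b ≤ ∑ j, p j ^ b :=
      Finset.single_le_sum (f := fun j => p j ^ b) (fun j _ => Real.rpow_nonneg (hp.1 j) b)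
        (Finset.mem_univ i)
    have hlog := Real.log_le_log (Real.rpow_pos_of_pos hi b) hS
    rw [Real.log_rpow hi] at hlog
    have hb1 : 0 < b - 1 := by linarith
    have e1 : b / (b - 1) * -Real.log (p i) = -(b * Real.log (p i)) / (b - 1) := by ring
    have e2 : 1 / (1 - b) * Real.log (∑ i, p i ^ b) = -Real.log (∑ i, p i ^ b) / (b - 1) := by
      rw [← neg_sub b 1, one_div, inv_neg]
      field_simp
    rw [e1, e2]
    exact div_le_div_of_nonneg_right (neg_le_neg hlog) hb1.le

theorem sum_rpow_eq_exp {n : ℕ} {α : ℝ≥0∞} (h0 : α ≠ 0) (h1 : α ≠ 1) (ht : α ≠ ∞)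
    {p : Fin n → ℝ} (hp : p ∈ stdSimplex ℝ (Fin n)) :
    ∑ i, p i ^ α.toReal = Real.exp ((1 - α.toReal) * renyiEntropy α p) := by
  have : 1 - α.toReal ≠ 0 := sub_ne_zero.2 (toReal_ne_one h1).symm
  rw [renyiEntropy_of_ne h0 h1 ht, ← mul_assoc, mul_one_div_cancel this, one_mul,
    Real.exp_log (sum_rpow_pos hp _)]

/-- The sequence `x` parametrizes spiked distributions with entropy `h` of order `α`. -/
def IsSpikeSeq (α : ℝ≥0∞) (h : ℝ) (x : ℕ → ℝ) : Prop :=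
  ∀ᶠ m : ℕ in Filter.atTop, m ≠ 0 ∧ x m ∈ Set.Icc (1 / (m + 1 : ℝ)) 1 ∧
    renyiEntropy α (spikeDist m (x m)) = h

theorem exists_isSpikeSeq {α : ℝ≥0∞} (h0 : α ≠ 0) (ht : α ≠ ∞) {h : ℝ} (hh : 0 < h) :
    ∃ x, IsSpikeSeq α h x := by
  have hex : ∀ m : ℕ, ∃ x, m ≠ 0 → h ≤ Real.log (m + 1) →
      x ∈ Set.Icc (1 / (m + 1 : ℝ)) 1 ∧ renyiEntropy α (spikeDist m x) = h := by
    intro m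
    by_cases hm : m ≠ 0 ∧ h ≤ Real.log (m + 1)
    · obtain ⟨x, hx⟩ := exists_renyiEntropy_spikeDist_eq hm.1 h0 ht hh.le hm.2
      exact ⟨x, fun _ _ => hx⟩
    · exact ⟨0, fun h1 h2 => absurd ⟨h1, h2⟩ hm⟩
  choose x hx using hex
  have hlog : Filter.Tendsto (fun m : ℕ => Real.log (m + 1)) Filter.atTop Filter.atTop :=
    Real.tendsto_log_atTop.comp
      (Filter.tendsto_atTop_add_const_right _ _ tendsto_natCast_atTop_atTop)
  refine ⟨x, ?_⟩
  filter_upwards [hlog.eventually_ge_atTop h, Filter.eventually_ne_atTop 0] with m h1 h2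
  exact ⟨h2, hx m h2 h1⟩

namespace IsSpikeSeq

variable {α : ℝ≥0∞} {h : ℝ} {x : ℕ → ℝ}

theorem mem (hx : IsSpikeSeq α h x) : ∀ᶠ m : ℕ in Filter.atTop, m ≠ 0 ∧ 0 < x m ∧ x m ≤ 1 ∧
    spikeDist m (x m) ∈ stdSimplex ℝ (Fin (m + 1)) := by
  filter_upwards [hx] with m ⟨h0, h1, _⟩
  have hpos : 0 < x m := lt_of_lt_of_le (by positivity) h1.1
  exact ⟨h0, hpos, h1.2, spikeDist_mem h0 hpos.le h1.2⟩

theorem base_bounds (hx : IsSpikeSeq α h x) :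
    ∀ᶠ m : ℕ in Filter.atTop, 0 ≤ (1 - x m) / m ∧ (1 - x m) / m ≤ 1 / m := by
  filter_upwards [hx.mem] with m ⟨_, h0, h1, _⟩
  exact ⟨div_nonneg (by linarith) (Nat.cast_nonneg m),
    div_le_div_of_nonneg_right (by linarith) (Nat.cast_nonneg m)⟩

theorem sum_eq (hx : IsSpikeSeq α h x) (h0 : α ≠ 0) (h1 : α ≠ 1) (ht : α ≠ ∞) :
    ∀ᶠ m : ℕ in Filter.atTop, m * ((1 - x m) / m) ^ α.toReal + x m ^ α.toReal =
      Real.exp ((1 - α.toReal) * h) := by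
  filter_upwards [hx, hx.mem] with m ⟨_, _, hm⟩ ⟨_, _, _, hmem⟩
  have := sum_rpow_eq_exp h0 h1 ht hmem
  rwa [hm, sum_spikeDist m (x m) fun t => t ^ α.toReal] at this

theorem tendsto_mul_rpow (hx : IsSpikeSeq α h x) (h0 : α ≠ 0) (h1 : α ≠ 1) (ht : α ≠ ∞) {b : ℝ}
    (hb : α.toReal < b) :
    Filter.Tendsto (fun m : ℕ => m * ((1 - x m) / m) ^ b) Filter.atTop (nhds 0) := by
  refine tendsto_mul_rpow_zero hb (C := Real.exp ((1 - α.toReal) * h)) ?_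
    (ENNReal.toReal_pos h0 ht)
  filter_upwards [hx.base_bounds, hx.sum_eq h0 h1 ht, hx.mem] with m ⟨hm0, hm1⟩ hs ⟨_, hp, _, _⟩
  have := Real.rpow_nonneg hp.le α.toReal
  exact ⟨hm0, hm1, by linarith⟩

theorem tendsto_one (hx : IsSpikeSeq α h x) (h0 : α ≠ 0) (h1 : α ≤ 1) :
    Filter.Tendsto x Filter.atTop (nhds 1) := by
  have key : Filter.Tendsto (fun m => 1 - x m) Filter.atTop (nhds 0) := by
    -- At order 1, `q ≤ 1 / m` turns the entropy identity into `(1 - x) * log m ≤ h`. Below order 1,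
    -- the mass `1 - x = m * q` tends to 0 since exponent 1 exceeds the order.
    rcases h1.eq_or_lt with rfl | hlt
    · have hlim : Filter.Tendsto (fun m : ℕ => h / Real.log m) Filter.atTop (nhds 0) :=
        (Real.tendsto_log_atTop.comp tendsto_natCast_atTop_atTop).const_div_atTop h
      refine squeeze_zero' ?_ ?_ hlim
      · filter_upwards [hx.mem] with m ⟨_, _, hm, _⟩
        linarith
      · filter_upwards [hx, hx.mem, hx.base_bounds, Filter.eventually_gt_atTop 1] with
          m ⟨_, _, he⟩ ⟨hm0, hp, hle, _⟩ ⟨hq0, hq1⟩ hm1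
        have hmpos : (0 : ℝ) < m := by positivity
        have hlogm : 0 < Real.log m := Real.log_pos (by exact_mod_cast hm1)
        rw [renyiEntropy_one, sum_spikeDist m (x m) fun t => t * Real.log t] at he
        have hxl : x m * Real.log (x m) ≤ 0 :=
          mul_nonpos_of_nonneg_of_nonpos hp.le (Real.log_nonpos hp.le hle)
        have hmq : m * ((1 - x m) / m) = 1 - x m := by field_simp
        have hql : (1 - x m) * Real.log m ≤ -((1 - x m) * Real.log ((1 - x m) / m)) := by
          rcases hle.eq_or_lt with h1 | h1
          · simp [h1]
          · have hqpos : 0 < (1 - x m) / m := div_pos (by linarith) hmpos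
            have := Real.log_le_log hqpos hq1
            rw [one_div, Real.log_inv] at this
            nlinarith
        rw [le_div_iff₀ hlogm]
        rw [← mul_assoc, hmq] at he
        linarith
    · have ht : α ≠ ∞ := hlt.ne_top
      have ha : α.toReal < 1 := by
        simpa using (ENNReal.toReal_lt_toReal ht ENNReal.one_ne_top).2 hlt
      refine (hx.tendsto_mul_rpow h0 hlt.ne ht ha).congr' ?_
      filter_upwards [hx.mem] with m ⟨hm, _⟩
      rw [Real.rpow_one]
      field_simp
  simpa using key.const_sub 1

theorem tendsto_exp (hx : IsSpikeSeq α h x) (h1 : 1 < α) (ht : α ≠ ∞) :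
    Filter.Tendsto x Filter.atTop
      (nhds (Real.exp (-((α.toReal - 1) / α.toReal * h)))) := by
  have h0 : α ≠ 0 := (zero_lt_one.trans h1).ne'
  have ha : 1 < α.toReal := by
    simpa using (ENNReal.toReal_lt_toReal ENNReal.one_ne_top ht).2 h1
  have hlim : Filter.Tendsto (fun m : ℕ => m * ((1 - x m) / m) ^ α.toReal) Filter.atTop
      (nhds 0) := by
    -- Total mass bounds `m * q` by 1, so the limit of `x ^ α` is the whole prescribed power sum.
    refine tendsto_mul_rpow_zero ha (C := 1) ?_ one_pos
    filter_upwards [hx.mem, hx.base_bounds] with m ⟨hm, hp, _, _⟩ ⟨hq0, hq1⟩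
    refine ⟨hq0, hq1, ?_⟩
    rw [Real.rpow_one, mul_div_cancel₀ _ (by positivity)]
    linarith
  have hpow := ((hlim.const_sub (Real.exp ((1 - α.toReal) * h))).rpow_const
    (p := α.toReal⁻¹) (Or.inr (by positivity)))
  rw [sub_zero, ← Real.exp_mul] at hpow
  have he : (1 - α.toReal) * h * α.toReal⁻¹ = -((α.toReal - 1) / α.toReal * h) := by
    field_simp
    ring
  rw [he] at hpow
  refine hpow.congr' ?_
  filter_upwards [hx.mem, hx.sum_eq h0 h1.ne' ht] with m ⟨_, hp, _, _⟩ hs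
  rw [← hs, add_sub_cancel_left, ← Real.rpow_mul hp.le, mul_inv_cancel₀ (by linarith),
    Real.rpow_one]

theorem tendsto_renyiEntropy_of_le_one (hx : IsSpikeSeq α h x) (h0 : α ≠ 0) {β : ℝ≥0∞}
    (hαβ : α < β) (hβ : β ≤ 1) :
    Filter.Tendsto (fun m => renyiEntropy β (spikeDist m (x m))) Filter.atTop (nhds 0) := by
  have hα1 : α < 1 := hαβ.trans_le hβ
  have ht : α ≠ ∞ := hα1.ne_top
  have ha : 0 < α.toReal := ENNReal.toReal_pos h0 ht
  have hx1 := hx.tendsto_one h0 hα1.le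
  rcases hβ.eq_or_lt with rfl | hlt
  · have ha1 : α.toReal < 1 := by
      simpa using (ENNReal.toReal_lt_toReal ht ENNReal.one_ne_top).2 hα1
    -- An intermediate exponent absorbs the logarithm: `|q * log q| ≤ q ^ b / (1 - b)`, and `m * q ^
    -- b → 0`.
    obtain ⟨b, hab, hb1⟩ := exists_between ha1
    have hd : 0 < 1 - b := by linarith
    have hq : Filter.Tendsto (fun m : ℕ => m * ((1 - x m) / m * Real.log ((1 - x m) / m)))
        Filter.atTop (nhds 0) := by
      have hlim := (hx.tendsto_mul_rpow h0 hα1.ne ht hab).mul_const (1 / (1 - b))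
      rw [zero_mul] at hlim
      refine squeeze_zero_norm' ?_ hlim
      filter_upwards [hx.mem, hx.base_bounds] with m ⟨hm, hp, hle, _⟩ ⟨hq0, hq1⟩
      have hm1 : (1 : ℝ) ≤ m := by exact_mod_cast Nat.one_le_iff_ne_zero.2 hm
      set q := (1 - x m) / m
      rw [Real.norm_eq_abs, abs_mul, abs_of_nonneg (Nat.cast_nonneg m), mul_assoc]
      refine mul_le_mul_of_nonneg_left ?_ (Nat.cast_nonneg m)
      rcases hq0.eq_or_lt with h | hqpos
      · rw [← h]
        simp only [zero_mul, abs_zero]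
        positivity
      · have hle1 : q ≤ 1 := hq1.trans ((div_le_one (by linarith)).2 hm1)
        have hb := (Real.abs_log_mul_self_rpow_lt q (1 - b) hqpos hle1 hd).le
        have hs : q * Real.log q = q ^ b * (Real.log q * q ^ (1 - b)) := by
          rw [mul_left_comm, ← Real.rpow_add hqpos, add_sub_cancel, Real.rpow_one, mul_comm]
        rw [hs, abs_mul, abs_of_nonneg (Real.rpow_nonneg hq0 b)]
        exact mul_le_mul_of_nonneg_left hb (Real.rpow_nonneg hq0 b)
    have hxl := (Real.continuous_mul_log.tendsto 1).comp hx1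
    have := (hq.add hxl).neg
    simp only [Real.log_one, mul_zero, add_zero, neg_zero] at this
    refine this.congr fun m => ?_
    rw [renyiEntropy_one, sum_spikeDist m (x m) fun t => t * Real.log t]
    rfl
  · have htβ : β ≠ ∞ := hlt.ne_top
    have hlim := hx.tendsto_mul_rpow h0 hα1.ne ht ((ENNReal.toReal_lt_toReal ht htβ).2 hαβ)
    have hxp := hx1.rpow_const (p := β.toReal) (Or.inl one_ne_zero)
    have := ((hlim.add hxp).log (by simp)).const_mul (1 / (1 - β.toReal))
    rw [Real.one_rpow, zero_add, Real.log_one, mul_zero] at this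
    refine this.congr fun m => ?_
    rw [renyiEntropy_of_ne (pos_of_gt hαβ).ne' hlt.ne htβ,
      sum_spikeDist m (x m) fun t => t ^ β.toReal]

/-- An upper bound converging to the claimed infimum is enough. For `β > 1` it depends on the large
coordinate alone; for `β ≤ 1` the entropy itself tends to 0. -/
theorem exists_tendsto_bound (hx : IsSpikeSeq α h x) (h0 : α ≠ 0) {β : ℝ≥0∞} (hαβ : α < β) :
    ∃ u : ℕ → ℝ, (∀ᶠ m : ℕ in Filter.atTop, renyiEntropy β (spikeDist m (x m)) ≤ u m) ∧
      Filter.Tendsto u Filter.atTop (nhds (entropyLowerBound α β h)) := by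
  rcases le_or_gt β 1 with hβ | hβ
  · refine ⟨_, Filter.Eventually.of_forall fun m => le_rfl, ?_⟩
    rw [entropyLowerBound, if_pos (hαβ.le.trans hβ)]
    exact hx.tendsto_renyiEntropy_of_le_one h0 hαβ hβ
  · refine ⟨fun m => orderRatio β * -Real.log (x m), ?_, ?_⟩
    · filter_upwards [hx.mem] with m ⟨_, hp, _, hmem⟩
      have hlast : spikeDist m (x m) (Fin.last m) = x m := by simp [spikeDist]
      simpa only [hlast] using
        renyiEntropy_le_orderRatio_mul hβ hmem (i := Fin.last m) (hlast.symm ▸ hp)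
    · unfold entropyLowerBound
      split_ifs with hα
      · simpa using (((hx.tendsto_one h0 hα).log one_ne_zero).neg.const_mul (orderRatio β))
      · have := (((hx.tendsto_exp (not_le.1 hα) hαβ.ne_top).log
          (Real.exp_ne_zero _)).neg.const_mul (orderRatio β))
        rwa [Real.log_exp, neg_neg, ← mul_assoc] at this

end IsSpikeSeq

theorem theorem3 (α₁ α₂ : ℝ≥0∞) (h₁ : 0 < α₁) (h₁₂ : α₁ < α₂) :
    (∀ (n : ℕ) (P : Fin n → ℝ), P ∈ stdSimplex ℝ (Fin n) →
      ∃ Q ∈ segment ℝ (uniformDist n 1) (uniformDist n n),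
        Q ∈ stdSimplex ℝ (Fin n) ∧ renyiEntropy α₁ Q = renyiEntropy α₁ P ∧
        ∀ R ∈ stdSimplex ℝ (Fin n), renyiEntropy α₁ R = renyiEntropy α₁ P →
          renyiEntropy α₂ Q ≤ renyiEntropy α₂ R) ∧
    (∀ h : ℝ, 0 < h →
      (∀ (n : ℕ) (P : Fin n → ℝ), P ∈ stdSimplex ℝ (Fin n) → renyiEntropy α₁ P = h →
        entropyLowerBound α₁ α₂ h < renyiEntropy α₂ P) ∧
      IsGLB {x : ℝ | ∃ (n : ℕ) (P : Fin n → ℝ), P ∈ stdSimplex ℝ (Fin n) ∧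
          renyiEntropy α₁ P = h ∧ renyiEntropy α₂ P = x}
        (entropyLowerBound α₁ α₂ h)) := by
  refine ⟨exists_mem_segment_renyiEntropy_le α₁ α₂ h₁ h₁₂, fun h hh => ?_⟩
  have hlt : ∀ (n : ℕ) (P : Fin n → ℝ), P ∈ stdSimplex ℝ (Fin n) → renyiEntropy α₁ P = h →
      entropyLowerBound α₁ α₂ h < renyiEntropy α₂ P :=
    fun n P hP hPh => entropyLowerBound_lt_renyiEntropy α₁ α₂ h₁ h₁₂ hh hP hPh
  refine ⟨hlt, ?_, fun c hc => ?_⟩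
  · rintro _ ⟨n, P, hP, hPh, rfl⟩
    exact (hlt n P hP hPh).le
  · obtain ⟨x, hx⟩ := exists_isSpikeSeq h₁.ne' h₁₂.ne_top hh
    obtain ⟨u, hu, hlim⟩ := hx.exists_tendsto_bound h₁.ne' h₁₂
    -- Any lower bound `c` lies below the entropy of each eventual spike, hence below the limit of
    -- `u`.
    refine ge_of_tendsto hlim ?_
    filter_upwards [hu, hx, hx.mem] with m hm ⟨_, _, he⟩ ⟨_, _, _, hmem⟩
    exact (hc ⟨m + 1, spikeDist m (x m), hmem, he, rfl⟩).trans hm
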